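/- Let $K$ be an algebraically closed field, $m,n\ge 0$ integers, and let $I\subset K[t_0,\dots,t_m,x_0,\dots,x_n]$ be a bihomogeneous ideal, i.e. an ideal that is homogeneous for the $\mathbb{N}^2$-grading in which each $t_i$ has degree $(1,0)$ and each $x_j$ has degree $(0,1)$. Put $$I:\langle t_0,\dots,t_m\rangle^\infty=\{f\in K[t_0,\dots,t_m,x_0,\dots,x_n] \mid \exists N\in\mathbb{N}\ \forall g\in\langle t_0,\dots,t_m\rangle:\ fg^N\in I\},$$ $$\hat I=(I:\langle t_0,\dots,t_m\rangle^\infty)\cap K[x_0,\dots,x_n],$$ $$V(I)=\{(t,x)\in\mathbb{P}^m_K\times\mathbb{P}^n_K \mid f(t,x)=0\text{ for all bihomogeneous } f\in I\}.$$ Then the projective elimination ideal $\hat I\subset K[x_0,\dots,x_n]$ is homogeneous, and with $\pi:\mathbb{P}^m_K\times\mathbb{P}^n_K\to\mathbb{P}^n_K$ the projection onto the second factor, $$\pi(V(I))=V(\hat I),$$ where $V(\hat I)\subset\mathbb{P}^n_K$ is the set of common zeros of the homogeneous elements of $\hat I$. -/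

import Mathlib

open MvPolynomial
open scoped LinearAlgebra.Projectivization

namespace ProjElim

noncomputable section

/-- The saturation `I : J^∞ = {f | ∃ N, ∀ g ∈ J, f * g ^ N ∈ I}` of an ideal `I` by an ideal `J`. -/
def saturation {R : Type*} [CommRing R] (I J : Ideal R) : Ideal R where
  carrier := {f | ∃ N : ℕ, ∀ g ∈ J, f * g ^ N ∈ I}
  zero_mem' := ⟨0, fun g _ => by simp⟩
  add_mem' := by
    rintro a b ⟨N, hN⟩ ⟨M, hM⟩
    refine ⟨N + M, fun g hg => ?_⟩
    have h1 := I.mul_mem_right (g ^ M) (hN g hg)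
    have h2 := I.mul_mem_right (g ^ N) (hM g hg)
    have h3 : (a + b) * g ^ (N + M) = a * g ^ N * g ^ M + b * g ^ M * g ^ N := by ring
    rw [h3]
    exact I.add_mem h1 h2
  smul_mem' := by
    rintro c a ⟨N, hN⟩
    refine ⟨N, fun g hg => ?_⟩
    rw [smul_eq_mul, mul_assoc]
    exact I.mul_mem_left c (hN g hg)

/-- The polynomial ring `K[t₀, …, t_m, x₀, …, x_n]`; `Sum.inl i` is the index of `t_i` and
`Sum.inr j` the index of `x_j`. -/
abbrev BiPoly (K : Type*) [Field K] (m n : ℕ) : Type _ :=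
  MvPolynomial (Fin (m + 1) ⊕ Fin (n + 1)) K

/-- The bidegrees of the variables: `t_i` has bidegree `(1, 0)` and `x_j` has bidegree `(0, 1)`. -/
def bidegree (m n : ℕ) : Fin (m + 1) ⊕ Fin (n + 1) → ℕ × ℕ :=
  Sum.elim (fun _ => (1, 0)) (fun _ => (0, 1))

/-- `f` is homogeneous of some degree `a` in the `t_i` and of some degree `b` in the `x_j`. -/
def IsBihomogeneous {K : Type*} [Field K] {m n : ℕ} (f : BiPoly K m n) : Prop :=
  ∃ a b : ℕ, IsWeightedHomogeneous (bidegree m n) f (a, b)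

/-- The ideal `I ⊆ K[t, x]` is homogeneous for the bigrading by `ℕ × ℕ`: it contains all
bihomogeneous components of each of its elements. -/
def IsBihomogeneousIdeal {K : Type*} [Field K] {m n : ℕ} (I : Ideal (BiPoly K m n)) : Prop :=
  letI := weightedGradedAlgebra K (bidegree m n)
  I.IsHomogeneous (weightedHomogeneousSubmodule K (bidegree m n))

/-- The ideal `J ⊆ K[x₀, …, x_n]` is homogeneous for the grading by total degree. -/
def IsHomogeneousIdeal {K : Type*} [Field K] {n : ℕ}
    (J : Ideal (MvPolynomial (Fin (n + 1)) K)) : Prop :=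
  letI := MvPolynomial.gradedAlgebra (σ := Fin (n + 1)) (R := K)
  J.IsHomogeneous (homogeneousSubmodule (Fin (n + 1)) K)

/-- The ideal `⟨t₀, …, t_m⟩` of `K[t, x]`. -/
def tIdeal (K : Type*) [Field K] (m n : ℕ) : Ideal (BiPoly K m n) :=
  Ideal.span (Set.range fun i : Fin (m + 1) => X (Sum.inl i))

/-- The projective elimination ideal `(I : ⟨t₀, …, t_m⟩^∞) ∩ K[x₀, …, x_n]`, where `K[x]` is
viewed inside `K[t, x]` through the inclusion `x_j ↦ x_j`. -/
def projElimIdeal {K : Type*} [Field K] {m n : ℕ} (I : Ideal (BiPoly K m n)) :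
    Ideal (MvPolynomial (Fin (n + 1)) K) :=
  (saturation I (tIdeal K m n)).comap (rename (R := K) (Sum.inr : _ → Fin (m + 1) ⊕ Fin (n + 1)))

/-- Projective space `ℙⁿ` over `K`: lines through the origin in `K^{n+1}`. -/
abbrev PSpace (K : Type*) [Field K] (n : ℕ) : Type _ := ℙ K (Fin (n + 1) → K)

/-- `V(I) ⊆ ℙ^m × ℙⁿ`: the common zeros of the bihomogeneous elements of `I`. The choice of
homogeneous coordinates is irrelevant, see `mk_mem_biZeroLocus`. -/
def biZeroLocus {K : Type*} [Field K] {m n : ℕ} (I : Ideal (BiPoly K m n)) :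
    Set (PSpace K m × PSpace K n) :=
  {p | ∀ f ∈ I, IsBihomogeneous f → eval (Sum.elim p.1.rep p.2.rep) f = 0}

/-- `V(J) ⊆ ℙⁿ`: the common zeros of the homogeneous elements of `J`. The choice of
homogeneous coordinates is irrelevant, see `mk_mem_projZeroLocus`. -/
def projZeroLocus {K : Type*} [Field K] {n : ℕ} (J : Ideal (MvPolynomial (Fin (n + 1)) K)) :
    Set (PSpace K n) :=
  {q | ∀ f ∈ J, (∃ d : ℕ, f.IsHomogeneous d) → eval q.rep f = 0}

theorem eval_smul_of_isWeightedHomogeneous {K : Type*} [Field K] {m n : ℕ} {f : BiPoly K m n}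
    {a b : ℕ} (hf : IsWeightedHomogeneous (bidegree m n) f (a, b)) (r s : K)
    (u : Fin (m + 1) → K) (v : Fin (n + 1) → K) :
    eval (Sum.elim (r • u) (s • v)) f = r ^ a * s ^ b * eval (Sum.elim u v) f := by
  rw [eval_eq', eval_eq', Finset.mul_sum]
  refine Finset.sum_congr rfl fun d hd => ?_
  have h := hf (mem_support_iff.mp hd)
  rw [Finsupp.weight_apply, Finsupp.sum_fintype _ _ (by simp)] at h
  have h1 : ∑ i, d (Sum.inl i) = a := by
    have := congrArg Prod.fst h
    simpa [bidegree, Fintype.sum_sum_type, Prod.fst_sum] using this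
  have h2 : ∑ i, d (Sum.inr i) = b := by
    have := congrArg Prod.snd h
    simpa [bidegree, Fintype.sum_sum_type, Prod.snd_sum] using this
  simp only [Fintype.prod_sum_type, Sum.elim_inl, Sum.elim_inr, Pi.smul_apply, smul_eq_mul,
    mul_pow, Finset.prod_mul_distrib, Finset.prod_pow_eq_pow_sum, h1, h2]
  ring

theorem mk_mem_biZeroLocus {K : Type*} [Field K] {m n : ℕ} (I : Ideal (BiPoly K m n))
    (u : Fin (m + 1) → K) (hu : u ≠ 0) (v : Fin (n + 1) → K) (hv : v ≠ 0) :
    (Projectivization.mk K u hu, Projectivization.mk K v hv) ∈ biZeroLocus I ↔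
      ∀ f ∈ I, IsBihomogeneous f → eval (Sum.elim u v) f = 0 := by
  obtain ⟨r, hr⟩ := Projectivization.exists_smul_eq_mk_rep K u hu
  obtain ⟨s, hs⟩ := Projectivization.exists_smul_eq_mk_rep K v hv
  refine forall₂_congr fun f _ => forall_congr' fun hf => ?_
  obtain ⟨a, b, hab⟩ := hf
  have h := eval_smul_of_isWeightedHomogeneous hab (r : K) (s : K) u v
  change eval (Sum.elim (Projectivization.mk K u hu).rep (Projectivization.mk K v hv).rep) f = 0 ↔ _
  rw [← hr, ← hs, Units.smul_def, Units.smul_def, h]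
  simp

theorem mk_mem_projZeroLocus {K : Type*} [Field K] {n : ℕ}
    (J : Ideal (MvPolynomial (Fin (n + 1)) K)) (v : Fin (n + 1) → K) (hv : v ≠ 0) :
    Projectivization.mk K v hv ∈ projZeroLocus J ↔
      ∀ f ∈ J, (∃ d : ℕ, f.IsHomogeneous d) → eval v f = 0 := by
  obtain ⟨s, hs⟩ := Projectivization.exists_smul_eq_mk_rep K v hv
  refine forall₂_congr fun f _ => forall_congr' fun hf => ?_
  obtain ⟨d, hd⟩ := hf
  have h : eval ((s : K) • v) f = (s : K) ^ d * eval v f := by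
    rw [eval_eq', eval_eq', Finset.mul_sum]
    refine Finset.sum_congr rfl fun e he => ?_
    have h1 : ∑ i, e i = d := by
      have := hd (mem_support_iff.mp he)
      rw [Finsupp.weight_apply, Finsupp.sum_fintype _ _ (by simp)] at this
      simpa using this
    simp only [Pi.smul_apply, smul_eq_mul, mul_pow, Finset.prod_mul_distrib,
      Finset.prod_pow_eq_pow_sum, h1]
    ring
  rw [← hs, Units.smul_def, h]
  simp

end

end ProjElim

/-! ### Nakayama's lemma in a single degree -/

namespace MvPolynomial

/-! For `π(V(I)) ⊆ V(Î)`: a point `(u, v)` of `V(I)` kills `f * t_i ^ N`, and some `u i` is nonzero,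
so `f` vanishes at `v`. For the converse, read `K[t, x]` as `K[x][t]` and let `𝔪` be the kernel of
evaluation at `v`. If the fibre over `v` were empty, the Nullstellensatz (`X_inl_mem_radical`) would
put all forms of some degree `D` in `t` into `I + 𝔪 K[t, x]`. These forms make up a finite
`K[x]`-module, so Nakayama (`exists_sub_one_mem_and_C_mul_mem`) gives `r ∈ 1 + 𝔪` multiplying all of
them into `I`. Then `r ∈ Î` and `r(v) = 1`, whereas `Î`, being homogeneous, vanishes at `v`. -/

theorem homogeneousComponent_mem_smul_of_mem_map_C {σ R : Type*} [CommRing R] {𝔞 : Ideal R}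
    {p : MvPolynomial σ R} (hp : p ∈ 𝔞.map C) (d : ℕ) :
    homogeneousComponent d p ∈ 𝔞 • homogeneousSubmodule σ R d := by
  rw [mem_map_C_iff] at hp
  rw [homogeneousComponent_apply]
  refine Submodule.sum_mem _ fun e he => ?_
  rw [← mul_one (coeff e p), ← smul_eq_mul, ← smul_monomial]
  exact Submodule.smul_mem_smul (hp e) (isHomogeneous_monomial _ (Finset.mem_filter.mp he).2)

/-- If a homogeneous ideal contains, modulo `𝔞`, every power product of degree `d` of the
variables, then some `r ≡ 1 mod 𝔞` multiplies all of these into the ideal. -/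
theorem exists_sub_one_mem_and_C_mul_mem {σ R : Type*} [CommRing R] [Finite σ]
    {J : Ideal (MvPolynomial σ R)} (hJ : ∀ p ∈ J, ∀ d, homogeneousComponent d p ∈ J)
    {𝔞 : Ideal R} {d : ℕ} (h : idealOfVars σ R ^ d ≤ J ⊔ 𝔞.map C) :
    ∃ r : R, r - 1 ∈ 𝔞 ∧ ∀ p : MvPolynomial σ R, p.IsHomogeneous d → C r * p ∈ J := by
  -- Taking degree-`d` components turns the inclusion of ideals into one of `R`-modules, with a
  -- finitely generated left side, as Nakayama requires.
  have hle : homogeneousSubmodule σ R d ≤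
      J.restrictScalars R ⊔ 𝔞 • homogeneousSubmodule σ R d := by
    intro p hp
    have hp' : p ∈ idealOfVars σ R ^ d := by
      rw [mem_pow_idealOfVars_iff]
      intro e he
      rw [Finsupp.degree_eq_weight_one]
      exact (hp (mem_support_iff.mp he)).ge
    obtain ⟨f, hf, g, hg, hfg⟩ := Submodule.mem_sup.mp (h hp')
    rw [← homogeneousComponent_eq_self (n := d) hp, ← hfg, map_add]
    exact Submodule.add_mem_sup (hJ f hf d) (homogeneousComponent_mem_smul_of_mem_map_C hg d)
  obtain ⟨r, hr, hrJ⟩ := Submodule.exists_sub_one_mem_and_smul_le_of_fg_of_le_sup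
    (homogeneousSubmodule_fg σ R d) le_rfl hle
  refine ⟨r, hr, fun p hp => ?_⟩
  rw [← smul_eq_C_mul]
  exact hrJ (Submodule.smul_mem_pointwise_smul p r _ hp)

end MvPolynomial

/-! ### Saturation, homogeneity of `Î`, and the inclusion `⊆` -/

namespace ProjElim

/-- The generators lie in the radical of `I : f`; since there are finitely many, one power of the
whole span lies in `I : f`. The exponent may have to grow. -/
theorem mem_saturation_span_of_forall_mul_pow_mem {R ι : Type*} [CommRing R] [Finite ι]
    {I : Ideal R} {x : ι → R} {f : R} {N : ℕ} (h : ∀ i, f * x i ^ N ∈ I) :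
    f ∈ saturation I (Ideal.span (Set.range x)) := by
  have hle : Ideal.span (Set.range x) ≤ (I.colon {f}).radical := by
    rw [Ideal.span_le]
    rintro _ ⟨i, rfl⟩
    refine ⟨N, Submodule.mem_colon_singleton.mpr ?_⟩
    rw [smul_eq_mul, mul_comm]
    exact h i
  obtain ⟨M, hM⟩ := Ideal.exists_pow_le_of_le_radical_of_fg hle
    (Submodule.fg_span (Set.finite_range x))
  refine ⟨M, fun g hg => ?_⟩
  have := Submodule.mem_colon_singleton.mp (hM (Ideal.pow_mem_pow hg M))
  rwa [smul_eq_mul, mul_comm] at this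

section

variable {K : Type*} [Field K] {m n : ℕ}

theorem mem_projElimIdeal_iff {I : Ideal (BiPoly K m n)} {f : MvPolynomial (Fin (n + 1)) K} :
    f ∈ projElimIdeal I ↔
      ∃ N : ℕ, ∀ i : Fin (m + 1), rename Sum.inr f * X (Sum.inl i) ^ N ∈ I := by
  constructor
  · rintro ⟨N, hN⟩
    exact ⟨N, fun i => hN _ (Ideal.subset_span ⟨i, rfl⟩)⟩
  · rintro ⟨N, hN⟩
    exact mem_saturation_span_of_forall_mul_pow_mem hN

theorem weight_bidegree (e : Fin (m + 1) ⊕ Fin (n + 1) →₀ ℕ) :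
    Finsupp.weight (bidegree m n) e = (∑ i, e (Sum.inl i), ∑ j, e (Sum.inr j)) := by
  rw [Finsupp.weight_apply, Finsupp.sum_fintype _ _ (by simp)]
  ext <;> simp [bidegree, Fintype.sum_sum_type, Prod.fst_sum, Prod.snd_sum]

theorem isWeightedHomogeneous_rename_inr {f : MvPolynomial (Fin (n + 1)) K} {d : ℕ}
    (hf : f.IsHomogeneous d) :
    IsWeightedHomogeneous (bidegree m n) (rename Sum.inr f) (0, d) := by
  classical
  intro e he
  obtain ⟨u, rfl, hu⟩ := coeff_rename_ne_zero _ _ _ he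
  have h := hf hu
  rw [Finsupp.weight_apply, Finsupp.sum_fintype _ _ (by simp)] at h
  rw [weight_bidegree]
  ext
  · simp [Finsupp.mapDomain_of_notMem_range]
  · simpa [Finsupp.mapDomain_apply Sum.inr_injective] using h

theorem isWeightedHomogeneous_rename_inr_mul_X_pow {f : MvPolynomial (Fin (n + 1)) K} {d : ℕ}
    (hf : f.IsHomogeneous d) (i : Fin (m + 1)) (N : ℕ) :
    IsWeightedHomogeneous (bidegree m n) (rename Sum.inr f * X (Sum.inl i) ^ N) (N, d) := by
  have h := (isWeightedHomogeneous_rename_inr (m := m) hf).mul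
    ((isWeightedHomogeneous_X K (bidegree m n) (Sum.inl i)).pow N)
  simpa [bidegree] using h

/-- Multiplication by `t_i ^ N` shifts bidegree `(0, d)` to `(N, d)`, so components of different
degrees stay apart. This carries homogeneity from `I` to `Î`. -/
theorem weightedHomogeneousComponent_rename_inr_mul_X_pow (f : MvPolynomial (Fin (n + 1)) K)
    (i : Fin (m + 1)) (N d : ℕ) :
    weightedHomogeneousComponent (bidegree m n) (N, d) (rename Sum.inr f * X (Sum.inl i) ^ N) =
      rename Sum.inr (homogeneousComponent d f) * X (Sum.inl i) ^ N := by
  conv_lhs => rw [← sum_homogeneousComponent f]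
  rw [map_sum, Finset.sum_mul, map_sum, Finset.sum_eq_single d]
  · exact (isWeightedHomogeneous_rename_inr_mul_X_pow
      (homogeneousComponent_isHomogeneous d f) i N).weightedHomogeneousComponent_same
  · intro b _ hb
    exact (isWeightedHomogeneous_rename_inr_mul_X_pow
      (homogeneousComponent_isHomogeneous b f) i N).weightedHomogeneousComponent_ne _
        (by simpa using hb.symm)
  · intro hd
    rw [homogeneousComponent_eq_zero d f (by simpa using hd)]
    simp

theorem IsBihomogeneousIdeal.weightedHomogeneousComponent_mem {I : Ideal (BiPoly K m n)}
    (hI : IsBihomogeneousIdeal I) {f : BiPoly K m n} (hf : f ∈ I) (c : ℕ × ℕ) :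
    weightedHomogeneousComponent (bidegree m n) c f ∈ I :=
  weightedHomogeneousComponent_mem_of_mem K (bidegree m n) hI hf c

theorem homogeneousComponent_mem_projElimIdeal {I : Ideal (BiPoly K m n)}
    (hI : IsBihomogeneousIdeal I) {f : MvPolynomial (Fin (n + 1)) K} (hf : f ∈ projElimIdeal I)
    (d : ℕ) : homogeneousComponent d f ∈ projElimIdeal I := by
  obtain ⟨N, hN⟩ := mem_projElimIdeal_iff.mp hf
  refine mem_projElimIdeal_iff.mpr ⟨N, fun i => ?_⟩
  rw [← weightedHomogeneousComponent_rename_inr_mul_X_pow]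
  exact hI.weightedHomogeneousComponent_mem (hN i) _

theorem isHomogeneousIdeal_projElimIdeal {I : Ideal (BiPoly K m n)}
    (hI : IsBihomogeneousIdeal I) : IsHomogeneousIdeal (projElimIdeal I) := by
  intro d f hf
  have h := homogeneousComponent_mem_projElimIdeal hI hf d
  rwa [← decomposition.decompose'_apply] at h

theorem eval_eq_zero_of_mem_projElimIdeal {I : Ideal (BiPoly K m n)} {u : Fin (m + 1) → K}
    (hu : u ≠ 0) {v : Fin (n + 1) → K}
    (h : ∀ f ∈ I, IsBihomogeneous f → eval (Sum.elim u v) f = 0)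
    {f : MvPolynomial (Fin (n + 1)) K} (hf : f ∈ projElimIdeal I) {d : ℕ}
    (hd : f.IsHomogeneous d) : eval v f = 0 := by
  obtain ⟨N, hN⟩ := mem_projElimIdeal_iff.mp hf
  obtain ⟨i, hi⟩ := Function.ne_iff.mp hu
  have h0 := h _ (hN i) ⟨N, d, isWeightedHomogeneous_rename_inr_mul_X_pow hd i N⟩
  rw [map_mul, eval_rename, Sum.elim_comp_inr, map_pow, eval_X, Sum.elim_inl] at h0
  exact (mul_eq_zero.mp h0).resolve_right (pow_ne_zero _ hi)

theorem eval_eq_zero_of_isBihomogeneousIdeal {I : Ideal (BiPoly K m n)}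
    {w : Fin (m + 1) ⊕ Fin (n + 1) → K} (hI : IsBihomogeneousIdeal I)
    (h : ∀ f ∈ I, IsBihomogeneous f → eval w f = 0) {f : BiPoly K m n} (hf : f ∈ I) :
    eval w f = 0 := by
  rw [← sum_weightedHomogeneousComponent (bidegree m n) f,
    finsum_eq_sum _ (weightedHomogeneousComponent_finsupp f), map_sum]
  exact Finset.sum_eq_zero fun c _ => h _ (hI.weightedHomogeneousComponent_mem hf c)
    ⟨c.1, c.2, weightedHomogeneousComponent_isWeightedHomogeneous c f⟩

/-! ### Passage to `K[x][t]` and nonempty fibres -/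

theorem sumAlgEquiv_rename_inr (f : MvPolynomial (Fin (n + 1)) K) :
    sumAlgEquiv K (Fin (m + 1)) (Fin (n + 1)) (rename Sum.inr f) = C f :=
  DFunLike.congr_fun
    (sumAlgEquiv_comp_rename_inr K (Fin (m + 1)) (Fin (n + 1))) f

theorem isHomogeneous_sumAlgEquiv {f : BiPoly K m n} {a b : ℕ}
    (hf : IsWeightedHomogeneous (bidegree m n) f (a, b)) :
    (sumAlgEquiv K (Fin (m + 1)) (Fin (n + 1)) f).IsHomogeneous a := by
  rw [f.as_sum, map_sum]
  refine IsHomogeneous.sum _ _ _ fun e he => ?_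
  have ha : ∑ i, e (Sum.inl i) = a := by
    have h := hf (mem_support_iff.mp he)
    rw [weight_bidegree] at h
    exact congrArg Prod.fst h
  have h1 : (∏ i, (X i : MvPolynomial (Fin (m + 1)) (MvPolynomial (Fin (n + 1)) K)) ^
      e (Sum.inl i)).IsHomogeneous a :=
    ha ▸ IsHomogeneous.prod Finset.univ _ _ fun i _ => isHomogeneous_X_pow i _
  have h2 : sumAlgEquiv K (Fin (m + 1)) (Fin (n + 1)) (monomial e (coeff e f)) =
      C (C (coeff e f) * ∏ j, X j ^ e (Sum.inr j)) * ∏ i, X i ^ e (Sum.inl i) := by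
    rw [monomial_eq, Finsupp.prod_fintype _ _ (fun _ => pow_zero _), Fintype.prod_sum_type]
    simp only [map_mul, map_prod, map_pow, sumAlgEquiv_C_inl, sumAlgEquiv_X_inl,
      sumAlgEquiv_X_inr]
    ring
  rw [h2]
  exact h1.C_mul _

/-- Each bihomogeneous component of an element of `I` is homogeneous in `t`, so taking the part of
`t`-degree `d` keeps it or kills it. -/
theorem homogeneousComponent_mem_map_sumAlgEquiv {I : Ideal (BiPoly K m n)}
    (hI : IsBihomogeneousIdeal I) (d : ℕ)
    {p : MvPolynomial (Fin (m + 1)) (MvPolynomial (Fin (n + 1)) K)}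
    (hp : p ∈ I.map (sumAlgEquiv K (Fin (m + 1)) (Fin (n + 1)))) :
    homogeneousComponent d p ∈ I.map (sumAlgEquiv K (Fin (m + 1)) (Fin (n + 1))) := by
  obtain ⟨f, hf, rfl⟩ := (Ideal.mem_map_of_equiv _ _).mp hp
  rw [← sum_weightedHomogeneousComponent (bidegree m n) f,
    finsum_eq_sum _ (weightedHomogeneousComponent_finsupp f), map_sum, map_sum]
  refine Ideal.sum_mem _ fun c _ => ?_
  have hc : IsWeightedHomogeneous (bidegree m n) _ (c.1, c.2) :=
    weightedHomogeneousComponent_isWeightedHomogeneous c f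
  rw [homogeneousComponent_of_mem (isHomogeneous_sumAlgEquiv hc)]
  split_ifs
  · exact Ideal.mem_map_of_mem _ (hI.weightedHomogeneousComponent_mem hf c)
  · exact Ideal.zero_mem _

/-- If no `u ≠ 0` is a zero of `I` above `v`, then the irrelevant ideal of the `t_i` lies in the
radical of `I` specialised at `v`. -/
theorem X_inl_mem_radical [IsAlgClosed K] {I : Ideal (BiPoly K m n)} {v : Fin (n + 1) → K}
    (h : ∀ u : Fin (m + 1) → K, (∀ f ∈ I, eval (Sum.elim u v) f = 0) → u = 0)
    (i : Fin (m + 1)) :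
    (X (Sum.inl i) : BiPoly K m n) ∈
      (I ⊔ (RingHom.ker (eval v)).map (rename (R := K) Sum.inr)).radical := by
  rw [← vanishingIdeal_zeroLocus_eq_radical (K := K)]
  intro w hw
  -- The elements `x_j - v_j` of the kernel pin the `x`-part of a common zero to `v`.
  have hv : w ∘ Sum.inr = v := by
    funext j
    have hj : X j - C (v j) ∈ RingHom.ker (eval v) := by simp [RingHom.mem_ker]
    have := hw _ (Ideal.mem_sup_right (Ideal.mem_map_of_mem (rename (R := K) Sum.inr) hj))
    simpa [sub_eq_zero] using this
  have hu : w ∘ Sum.inl = 0 := by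
    refine h _ fun f hf => ?_
    rw [← hv, Sum.elim_comp_inl_inr]
    simpa [aeval_eq_eval] using hw f (Ideal.mem_sup_left hf)
  simpa using congrFun hu i

theorem exists_ne_zero_eval_eq_zero [IsAlgClosed K] {I : Ideal (BiPoly K m n)}
    (hI : IsBihomogeneousIdeal I) {v : Fin (n + 1) → K}
    (hv : ∀ f ∈ projElimIdeal I, (∃ d : ℕ, f.IsHomogeneous d) → eval v f = 0) :
    ∃ u : Fin (m + 1) → K, u ≠ 0 ∧ ∀ f ∈ I, eval (Sum.elim u v) f = 0 := by
  by_contra! hcon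
  let φ := sumAlgEquiv K (Fin (m + 1)) (Fin (n + 1))
  have hX := X_inl_mem_radical (I := I) (v := v) fun u hu => by
    by_contra hu0
    obtain ⟨f, hf, hne⟩ := hcon u hu0
    exact hne (hu f hf)
  have hle : idealOfVars (Fin (m + 1)) (MvPolynomial (Fin (n + 1)) K) ≤
      (I.map φ ⊔ (RingHom.ker (eval v)).map C).radical := by
    rw [idealOfVars, Ideal.span_le]
    rintro _ ⟨i, rfl⟩
    obtain ⟨N, hN⟩ := hX i
    refine ⟨N, ?_⟩
    have h := Ideal.mem_map_of_mem φ hN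
    rw [map_pow, sumAlgEquiv_X_inl, Ideal.map_sup] at h
    refine (sup_le_sup le_rfl ?_ : _ ≤ I.map φ ⊔ _) h
    rw [Ideal.map_le_iff_le_comap, Ideal.map_le_iff_le_comap]
    intro f hf
    rw [Ideal.mem_comap, Ideal.mem_comap, sumAlgEquiv_rename_inr]
    exact Ideal.mem_map_of_mem _ hf
  obtain ⟨D, hD⟩ := Ideal.exists_pow_le_of_le_radical_of_fg hle (idealOfVars_fg _ _)
  obtain ⟨r, hr, hrJ⟩ := exists_sub_one_mem_and_C_mul_mem
    (fun p hp d => homogeneousComponent_mem_map_sumAlgEquiv hI d hp) hD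
  have hrI : r ∈ projElimIdeal I := by
    refine mem_projElimIdeal_iff.mpr ⟨D, fun i => ?_⟩
    obtain ⟨f, hf, hfe⟩ := (Ideal.mem_map_of_equiv _ _).mp (hrJ _ (isHomogeneous_X_pow i D))
    have : f = rename Sum.inr r * X (Sum.inl i) ^ D := by
      apply (sumAlgEquiv K (Fin (m + 1)) (Fin (n + 1))).injective
      rw [hfe, map_mul, map_pow, sumAlgEquiv_rename_inr, sumAlgEquiv_X_inl]
    rwa [← this]
  -- `r` need not be homogeneous, but its components lie in `Î` and so vanish at `v`.
  have h0 : eval v r = 0 := by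
    rw [← sum_homogeneousComponent r, map_sum]
    exact Finset.sum_eq_zero fun d _ => hv _ (homogeneousComponent_mem_projElimIdeal hI hrI d)
      ⟨d, homogeneousComponent_isHomogeneous d r⟩
  rw [RingHom.mem_ker, map_sub, map_one, h0] at hr
  simp at hr

end

end ProjElim

theorem mainTheorem6 {K : Type*} [Field K] [IsAlgClosed K] (m n : ℕ)
    (I : Ideal (ProjElim.BiPoly K m n)) (hI : ProjElim.IsBihomogeneousIdeal I) :
    ProjElim.IsHomogeneousIdeal (ProjElim.projElimIdeal I) ∧
      (Prod.snd : ProjElim.PSpace K m × ProjElim.PSpace K n → ProjElim.PSpace K n) ''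
          ProjElim.biZeroLocus I =
        ProjElim.projZeroLocus (ProjElim.projElimIdeal I) := by
  refine ⟨ProjElim.isHomogeneousIdeal_projElimIdeal hI, Set.Subset.antisymm ?_ ?_⟩
  · rintro _ ⟨p, hp, rfl⟩ f hf ⟨d, hd⟩
    exact ProjElim.eval_eq_zero_of_mem_projElimIdeal p.1.rep_nonzero hp hf hd
  · intro q hq
    obtain ⟨u, hu, hI0⟩ := ProjElim.exists_ne_zero_eval_eq_zero hI hq
    refine ⟨(Projectivization.mk K u hu, q), ?_, rfl⟩
    rw [← q.mk_rep, ProjElim.mk_mem_biZeroLocus]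
    exact fun f hf _ => hI0 f hf
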